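/- Let $D$ be an oriented virtual link diagram, and let $\phi_+(D)$ be its parallel diagram. It is obtained by doubling every strand of $D$ into a right copy $R$ and a left copy $L$, both oriented like $D$. At each classical crossing, the $R$ copy of the over strand passes over both copies of the under strand with the original sign, and the two crossings on the $L$ copy of the over strand are virtual. Next to this crossing (just before or just after it), the two copies of the under strand are given a twist in which $R$ passes over $L$: at a positive crossing, a negative classical crossing followed by a virtual crossing; at a negative crossing, a virtual crossing followed by a positive classical crossing. Each virtual crossing is replaced by four virtual crossings. For a diagram $E$, the fundamental quandle $Q(E)$ is generated by the arcs of $E$. Its relations are: at each positive crossing $a*b=c$ and at each negative crossing $c*b=a$, where $b$ is the over arc and $a$, $c$ are the incoming and outgoing under arcs. Write $\mathrm{As}(Q)=\langle q\in Q \mid q*r=r^{-1}qr\rangle$ for the associated group of a quandle $Q$. For a word $w=z_1^{\varepsilon_1}\cdots z_k^{\varepsilon_k}$ with $\varepsilon_i=\pm1$, let $y^w$ be the result of applying to $y$ successively the operations $*z_i$ (if $\varepsilon_i=1$) or $\overline{*}\,z_i$ (if $\varepsilon_i=-1$), where $\overline{*}\,z$ is the inverse of $*z$. For a base edge $e$ of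 $D$, travel once along the component of $e$, starting from $e$, and write down $b^{\varepsilon}$ each time one passes under an arc $b$ at a crossing of sign $\varepsilon$, including the crossings with other components. The preferred longitude based at $e$ is the resulting word multiplied on the right by the power of the letter of $e$ that makes the total exponent sum zero, regarded as an element of $\mathrm{As}(Q(D))$. Let $\langle x_1,\dots,x_m\mid r_1,\dots,r_n\rangle_{\rm qdle}$ be any presentation of $Q(D)$. (1) If $D$ is a virtual knot diagram and $L$ is a word in $x_1,\dots,x_m$ that represents in $\mathrm{As}(Q(D))$ the preferred longitude based at an edge $e$, then $Q(\phi_+(D))$ has the presentation $$\langle x_1,\dots,x_m,y\mid r_1,\dots,r_n,\ y^L=y\rangle_{\rm qdle}.$$ (2) More generally, let $D$ have $\mu$ components, choose an edge $e_j$ on the $j$-th component for each $j$, and let $L_j$ be a word in $x_1,\dots,x_m$ that represents the preferred longitude based at $e_j$. Then $Q(\phi_+(D))$ has the presentation $$\langle x_1,\dots,x_m,y_1,\dots,y_\mu\mid r_1,\dots,r_n,\ y_j^{L_j}=y_j\ (j=1,\dots,\mu)\rangle_{\rm qdle}.$$ In both parts there is a quandle homomorphism $Q(D)\to Q(\phi_+(D))$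 that sends each arc of $D$ to its copy in the $R$ subdiagram. In the presentation, $x_i$ stands for the image of $x_i\in Q(D)$ under it, and $y$ (respectively $y_j$) stands for the arc of the $L$ subdiagram that is parallel to $e$ (respectively $e_j$) outside neighbourhoods of the crossings of $D$. -/

import Mathlib

open scoped Quandles

/-! ### Presentations of quandles

The right-handed operation `x * y` of the knot-theoretic literature is written `y ◃⁻¹ x` here, and
`x *̄ y` is `y ◃ x`.  With this dictionary `x * y = y⁻¹ x y` in a conjugation quandle, so that
`Rack.EnvelGroup Q` is the associated group `As(Q) = ⟨q ∈ Q | q * r = r⁻¹ q r⟩`. -/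

/-- Formal quandle expressions in the letters `ι`: `op a b` is `a * b`, `opInv a b` is `a *̄ b`. -/
inductive QuandleTerm (ι : Type*) where
  | var (i : ι) : QuandleTerm ι
  | op (a b : QuandleTerm ι) : QuandleTerm ι
  | opInv (a b : QuandleTerm ι) : QuandleTerm ι

/-- Words in the letters `ι` and their inverses; `(i, true)` is `i` and `(i, false)` is `i⁻¹`. -/
abbrev GroupWord (ι : Type*) := List (ι × Bool)

namespace QuandleTerm

/-- The expression `t ^ w`: successively `t ^ i = t * i` and `t ^ (i⁻¹) = t *̄ i` along the word. -/
def pow {ι : Type*} (t : QuandleTerm ι) (w : GroupWord ι) : QuandleTerm ι :=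
  w.foldl (fun s l => if l.2 then op s (var l.1) else opInv s (var l.1)) t

/-- Substitution of letters. -/
def map {ι ι' : Type*} (f : ι → ι') : QuandleTerm ι → QuandleTerm ι'
  | var i => var (f i)
  | op a b => op (map f a) (map f b)
  | opInv a b => opInv (map f a) (map f b)

/-- The congruence on quandle expressions generated by the relations `rel k` and the quandle
axioms. -/
inductive Rel {ι κ : Type*} (rel : κ → QuandleTerm ι × QuandleTerm ι) :
    QuandleTerm ι → QuandleTerm ι → Prop
  | of (k : κ) : Rel rel (rel k).1 (rel k).2
  | refl (a) : Rel rel a a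
  | symm {a b} : Rel rel a b → Rel rel b a
  | trans {a b c} : Rel rel a b → Rel rel b c → Rel rel a c
  | congr_op {a a' b b'} : Rel rel a a' → Rel rel b b' → Rel rel (op a b) (op a' b')
  | congr_opInv {a a' b b'} : Rel rel a a' → Rel rel b b' → Rel rel (opInv a b) (opInv a' b')
  | idem (a) : Rel rel (op a a) a
  | opInv_op (a b) : Rel rel (opInv (op a b) b) a
  | op_opInv (a b) : Rel rel (op (opInv a b) b) a
  | distrib (a b c) : Rel rel (op (op a b) c) (op (op a c) (op b c))

/-- The setoid of the generated congruence. -/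
def relSetoid {ι κ : Type*} (rel : κ → QuandleTerm ι × QuandleTerm ι) :
    Setoid (QuandleTerm ι) where
  r := Rel rel
  iseqv := ⟨Rel.refl, Rel.symm, Rel.trans⟩

end QuandleTerm

/-- The quandle `⟨ι | rel⟩` presented by generators `ι` and relations `(rel k).1 = (rel k).2`. -/
def PresentedQuandle {ι κ : Type*} (rel : κ → QuandleTerm ι × QuandleTerm ι) :=
  Quotient (QuandleTerm.relSetoid rel)

namespace PresentedQuandle

variable {ι κ : Type*} (rel : κ → QuandleTerm ι × QuandleTerm ι)

/-- The element of the presented quandle given by an expression. -/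
def mk (t : QuandleTerm ι) : PresentedQuandle rel := Quotient.mk (QuandleTerm.relSetoid rel) t

/-- The generators of the presented quandle. -/
def of (i : ι) : PresentedQuandle rel := mk rel (.var i)

instance instQuandle : Quandle (PresentedQuandle rel) where
  act x y := Quotient.map₂ (fun a b => QuandleTerm.opInv b a)
    (fun _ _ h _ _ h' => QuandleTerm.Rel.congr_opInv h' h) x y
  invAct x y := Quotient.map₂ (fun a b => QuandleTerm.op b a)
    (fun _ _ h _ _ h' => QuandleTerm.Rel.congr_op h' h) x y
  self_distrib := by
    rintro ⟨c⟩ ⟨b⟩ ⟨a⟩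
    refine Quotient.sound (show QuandleTerm.Rel rel (.opInv (.opInv a b) c)
      (.opInv (.opInv a c) (.opInv b c)) from ?_)
    generalize hA : QuandleTerm.opInv (.opInv a c) (.opInv b c) = A
    have h1 : QuandleTerm.Rel rel (.op (.op A (.opInv b c)) c) a := by
      rw [← hA]
      exact (QuandleTerm.Rel.congr_op (.op_opInv _ _) (.refl _)).trans (.op_opInv _ _)
    have h2 : QuandleTerm.Rel rel (.op (.op A c) b) a :=
      ((QuandleTerm.Rel.congr_op (.refl _) (QuandleTerm.Rel.op_opInv b c).symm).trans
        (QuandleTerm.Rel.distrib _ _ _).symm).trans h1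
    have h3 : QuandleTerm.Rel rel (.opInv a b) (.op A c) :=
      (QuandleTerm.Rel.congr_opInv h2.symm (.refl _)).trans (.opInv_op _ _)
    exact (QuandleTerm.Rel.congr_opInv h3 (.refl _)).trans (.opInv_op _ _)
  left_inv := by
    rintro ⟨b⟩ ⟨a⟩
    exact Quotient.sound (QuandleTerm.Rel.op_opInv a b)
  right_inv := by
    rintro ⟨b⟩ ⟨a⟩
    exact Quotient.sound (QuandleTerm.Rel.opInv_op a b)
  fix := by
    rintro ⟨a⟩
    exact Quotient.sound ((QuandleTerm.Rel.congr_opInv (.symm (.idem a)) (.refl a)).trans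
      (.opInv_op a a))

end PresentedQuandle

/-- `⟨ι | rel⟩` is a presentation of `Q` in which the letter `i` stands for `gen i`. -/
def IsQuandlePresentation {ι κ : Type*} (Q : Type*) [Quandle Q] (gen : ι → Q)
    (rel : κ → QuandleTerm ι × QuandleTerm ι) : Prop :=
  ∃ f : PresentedQuandle rel →◃ Q, Function.Bijective f ∧ ∀ i, f (PresentedQuandle.of rel i) = gen i

/-- From the relations `rel` in the letters `ι` and words `L j` in these letters, the relations
of `⟨ι, (y j) | rel, (y j) ^ (L j) = y j⟩`. -/
def addLongitudeRel {ι κ J : Type*} (rel : κ → QuandleTerm ι × QuandleTerm ι)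
    (L : J → GroupWord ι) : κ ⊕ J → QuandleTerm (ι ⊕ J) × QuandleTerm (ι ⊕ J)
  | .inl k => ((rel k).1.map Sum.inl, (rel k).2.map Sum.inl)
  | .inr j => (QuandleTerm.pow (.var (.inr j)) ((L j).map fun l => (Sum.inl l.1, l.2)),
      .var (.inr j))

/-- The value of a word in the associated group of `Q` when the letter `i` stands for `gen i`. -/
def wordValue {ι Q : Type*} [Quandle Q] (gen : ι → Q) (w : GroupWord ι) : Rack.EnvelGroup Q :=
  FreeGroup.lift (fun i => (Rack.toEnvelGroup Q (gen i) : Rack.EnvelGroup Q)) (FreeGroup.mk w)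

/-! ### Virtual link diagrams -/

/-- The passages of a link through its crossings, `C` being the classical and `V` the virtual
crossings.  Each crossing is drawn with both strands going upwards; at a virtual crossing
`left v` is the strand from the lower left to the upper right, `right v` the one from the lower
right to the upper left. -/
inductive Passage (C V : Type) where
  | over (c : C) : Passage C V
  | under (c : C) : Passage C V
  | left (v : V) : Passage C V
  | right (v : V) : Passage C V

/-- An oriented virtual link diagram, as a combinatorial (rotation) structure: finitely many
classical crossings with their signs, virtual crossings, closed curves without crossings, and for
every passage the passage that comes next along the link.  At a positive crossing (`sign c = true`)
the over strand is the one from the lower left to the upper right, at a negative one it is the one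
from the lower right to the upper left, so that the cyclic order of the four ends at each crossing
is recorded.  Every diagram in the plane is of this form.  The rotation structure is not required
to have genus zero. -/
structure VirtualLinkDiagram where
  Classical : Type
  Virtual : Type
  Circle : Type
  finite_classical : Finite Classical
  finite_virtual : Finite Virtual
  finite_circle : Finite Circle
  sign : Classical → Bool
  next : Equiv.Perm (Passage Classical Virtual)

namespace VirtualLinkDiagram

/-- The edges of the underlying 4-valent graph: `inl p` is the edge that leaves the passage `p`
and runs to the passage `D.next p`; `inr o` is a closed curve without crossings. -/
abbrev Edge (D : VirtualLinkDiagram) := Passage D.Classical D.Virtual ⊕ D.Circle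

/-- The relation imposed at a passage `p` on the edges before and after it.  Nothing changes
along over strands and at virtual crossings.  Under a positive crossing, `out = in * over`; under
a negative crossing, `out * over = in`. -/
def wirtingerRel (D : VirtualLinkDiagram) (p : Passage D.Classical D.Virtual) :
    QuandleTerm D.Edge × QuandleTerm D.Edge :=
  let before : QuandleTerm D.Edge := .var (.inl (D.next.symm p))
  let after : QuandleTerm D.Edge := .var (.inl p)
  match p with
  | .under c =>
      if D.sign c then (.op before (.var (.inl (.over c))), after)
      else (.op after (.var (.inl (.over c))), before)
  | _ => (after, before)

/-- The fundamental quandle of a diagram. -/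
abbrev FundamentalQuandle (D : VirtualLinkDiagram) := PresentedQuandle D.wirtingerRel

/-- The element of the fundamental quandle that belongs to (the arc containing) an edge. -/
def arc (D : VirtualLinkDiagram) (e : D.Edge) : D.FundamentalQuandle :=
  PresentedQuandle.of D.wirtingerRel e

/-- The edge that follows a given edge along the link. -/
def edgeNext (D : VirtualLinkDiagram) : Equiv.Perm D.Edge :=
  Equiv.sumCongr D.next (Equiv.refl D.Circle)

/-- The diagram has exactly one component. -/
def IsKnot (D : VirtualLinkDiagram) : Prop :=
  Nonempty D.Edge ∧ ∀ e e' : D.Edge, D.edgeNext.SameCycle e e'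

/-- `b` picks one edge on each component, so that the diagram has `μ` components. -/
def IsBase (D : VirtualLinkDiagram) {μ : ℕ} (b : Fin μ → D.Edge) : Prop :=
  ∀ e : D.Edge, ∃! i, D.edgeNext.SameCycle (b i) e

/-- The letter read off at a passage: the over strand, with the sign of the crossing, when one
passes under; nothing otherwise. -/
def passageWord (D : VirtualLinkDiagram) : Passage D.Classical D.Virtual → GroupWord D.Edge
  | .under c => [(.inl (.over c), D.sign c)]
  | _ => []

/-- The word read off along the component of an edge, travelling once around from this edge. -/
noncomputable def longitudeWord (D : VirtualLinkDiagram) : D.Edge → GroupWord D.Edge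
  | .inl p => (List.range (Function.minimalPeriod D.next p)).flatMap
      fun k => D.passageWord ((D.next ^ (k + 1)) p)
  | .inr _ => []

/-- The total exponent sum of a word. -/
def exponentSum {ι : Type*} (w : GroupWord ι) : ℤ :=
  (w.map fun l => if l.2 then (1 : ℤ) else -1).sum

/-- The preferred longitude based at the edge `e`, in the associated group of the fundamental
quandle: the word read off along the component, followed by the power of the letter of `e` that
makes the total exponent sum zero. -/
noncomputable def preferredLongitude (D : VirtualLinkDiagram) (e : D.Edge) :
    Rack.EnvelGroup D.FundamentalQuandle :=
  wordValue D.arc (D.longitudeWord e) *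
    (Rack.toEnvelGroup D.FundamentalQuandle (D.arc e) : Rack.EnvelGroup D.FundamentalQuandle) ^
      (-exponentSum (D.longitudeWord e))

end VirtualLinkDiagram

/-! ### The parallel diagram -/

/-- The two parallel copies: `R`, the main one on the right, and `L`, the secondary one on the
left. -/
inductive Side where
  | R : Side
  | L : Side

/-- The classical crossings of the parallel diagram.  `square c τ`: the `R` copy of the over
strand at `c` passes over the `τ` copy of the under strand.  `twist c`: in the twist on the two
copies of the under strand at `c`, the `R` copy passes over the `L` copy. -/
inductive ParallelClassical (C : Type) where
  | square (c : C) (τ : Side) : ParallelClassical C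
  | twist (c : C) : ParallelClassical C

/-- The virtual crossings of the parallel diagram.  `square c τ`: the `L` copy of the over strand
at `c` crosses the `τ` copy of the under strand.  `twist c`: the virtual crossing of the twist at
`c`.  `quad v σ τ`: the `σ` copy of the strand `left v` crosses the `τ` copy of `right v`. -/
inductive ParallelVirtual (C V : Type) where
  | square (c : C) (τ : Side) : ParallelVirtual C V
  | twist (c : C) : ParallelVirtual C V
  | quad (v : V) (σ τ : Side) : ParallelVirtual C V

/-- The passages of the parallel diagram, listed along the two copies.  `cross σ p k`: where the
`σ` copy of the strand `p` meets the two copies of the other strand of that crossing, first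
(`k = false`) and second (`k = true`).  `twist σ c k`: where the `σ` copy of the under strand at
`c` passes through the first and the second crossing of the twist. -/
inductive ParallelStep (C V : Type) where
  | cross (σ : Side) (p : Passage C V) (k : Bool) : ParallelStep C V
  | twist (σ : Side) (c : C) (k : Bool) : ParallelStep C V

namespace VirtualLinkDiagram

/-- Which crossing is met at each step, and by which strand.

A strand from the lower left to the upper right meets the `L` copy of the other strand
first and then its `R` copy; a strand from the lower right to the upper left meets `R` first
and then `L`.

In a twist the `L` copy enters on the left and the `R` copy on the right; they exchange
places at the first crossing and again at the second.  At a positive crossing the twist is a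
classical (negative) crossing followed by a virtual one; at a negative crossing it is a virtual
crossing followed by a classical (positive) one. -/
def stepToPassage (D : VirtualLinkDiagram) : ParallelStep D.Classical D.Virtual →
    Passage (ParallelClassical D.Classical) (ParallelVirtual D.Classical D.Virtual)
  | .cross .R (.over c) k =>
      match D.sign c, k with
      | true, false | false, true => .over (.square c .L)
      | true, true | false, false => .over (.square c .R)
  | .cross .L (.over c) k =>
      match D.sign c, k with
      | true, false => .left (.square c .L)
      | true, true => .left (.square c .R)
      | false, false => .right (.square c .R)
      | false, true => .right (.square c .L)
  | .cross τ (.under c) k =>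
      match D.sign c, k with
      | true, false => .under (.square c τ)
      | true, true => .right (.square c τ)
      | false, false => .left (.square c τ)
      | false, true => .under (.square c τ)
  | .cross σ (.left v) k =>
      match k with
      | false => .left (.quad v σ .L)
      | true => .left (.quad v σ .R)
  | .cross τ (.right v) k =>
      match k with
      | false => .right (.quad v .R τ)
      | true => .right (.quad v .L τ)
  | .twist .R c k =>
      match D.sign c, k with
      | true, false => .over (.twist c)
      | true, true => .left (.twist c)
      | false, false => .right (.twist c)
      | false, true => .over (.twist c)
  | .twist .L c k =>
      match D.sign c, k with
      | true, false => .under (.twist c)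
      | true, true => .right (.twist c)
      | false, false => .left (.twist c)
      | false, true => .under (.twist c)

/-- The inverse of `stepToPassage`. -/
def passageToStep (D : VirtualLinkDiagram) :
    Passage (ParallelClassical D.Classical) (ParallelVirtual D.Classical D.Virtual) →
      ParallelStep D.Classical D.Virtual
  | .over (.square c .L) => .cross .R (.over c) (!D.sign c)
  | .over (.square c .R) => .cross .R (.over c) (D.sign c)
  | .under (.square c τ) => .cross τ (.under c) (!D.sign c)
  | .over (.twist c) => .twist .R c (!D.sign c)
  | .under (.twist c) => .twist .L c (!D.sign c)
  | .left (.square c τ) =>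
      match D.sign c, τ with
      | true, .L => .cross .L (.over c) false
      | true, .R => .cross .L (.over c) true
      | false, τ => .cross τ (.under c) false
  | .right (.square c τ) =>
      match D.sign c, τ with
      | true, τ => .cross τ (.under c) true
      | false, .R => .cross .L (.over c) false
      | false, .L => .cross .L (.over c) true
  | .left (.twist c) =>
      match D.sign c with
      | true => .twist .R c true
      | false => .twist .L c false
  | .right (.twist c) =>
      match D.sign c with
      | true => .twist .L c true
      | false => .twist .R c false
  | .left (.quad v σ .L) => .cross σ (.left v) false
  | .left (.quad v σ .R) => .cross σ (.left v) true
  | .right (.quad v .R τ) => .cross τ (.right v) false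
  | .right (.quad v .L τ) => .cross τ (.right v) true

/-- The dictionary between steps and passages. -/
def stepEquiv (D : VirtualLinkDiagram) : ParallelStep D.Classical D.Virtual ≃
    Passage (ParallelClassical D.Classical) (ParallelVirtual D.Classical D.Virtual) where
  toFun := D.stepToPassage
  invFun := D.passageToStep
  left_inv := by
    rintro (⟨_ | _, c | c | v | v, _ | _⟩ | ⟨_ | _, c, _ | _⟩) <;>
      first
        | rfl
        | (cases h : D.sign c <;> simp [stepToPassage, passageToStep, h])
  right_inv := by
    rintro ((⟨c, _ | _⟩ | c) | (⟨c, _ | _⟩ | c) | (⟨c, _ | _⟩ | c | ⟨v, _ | _, _ | _⟩) |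
        (⟨c, _ | _⟩ | c | ⟨v, _ | _, _ | _⟩)) <;>
      first
        | rfl
        | (cases h : D.sign c <;> simp [stepToPassage, passageToStep, h])

/-- The first step of the `σ` copy at the passage `p`.  The twist at `c` lies on the under strand,
after the four crossings if `twistAfter c`, before them otherwise. -/
def firstStep (D : VirtualLinkDiagram) (twistAfter : D.Classical → Bool) (σ : Side) :
    Passage D.Classical D.Virtual → ParallelStep D.Classical D.Virtual
  | .under c => if twistAfter c then .cross σ (.under c) false else .twist σ c false
  | p => .cross σ p false

/-- The last step of the `σ` copy at the passage `p`. -/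
def lastStep (D : VirtualLinkDiagram) (twistAfter : D.Classical → Bool) (σ : Side) :
    Passage D.Classical D.Virtual → ParallelStep D.Classical D.Virtual
  | .under c => if twistAfter c then .twist σ c true else .cross σ (.under c) true
  | p => .cross σ p true

/-- The step that comes next along the copies. -/
def stepNextFun (D : VirtualLinkDiagram) (twistAfter : D.Classical → Bool) :
    ParallelStep D.Classical D.Virtual → ParallelStep D.Classical D.Virtual
  | .cross σ p false => .cross σ p true
  | .twist σ c false => .twist σ c true
  | .cross σ (.under c) true =>
      if twistAfter c then .twist σ c false else D.firstStep twistAfter σ (D.next (.under c))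
  | .cross σ p true => D.firstStep twistAfter σ (D.next p)
  | .twist σ c true =>
      if twistAfter c then D.firstStep twistAfter σ (D.next (.under c))
      else .cross σ (.under c) false

/-- The step that comes before along the copies. -/
def stepPrevFun (D : VirtualLinkDiagram) (twistAfter : D.Classical → Bool) :
    ParallelStep D.Classical D.Virtual → ParallelStep D.Classical D.Virtual
  | .cross σ p true => .cross σ p false
  | .twist σ c true => .twist σ c false
  | .cross σ (.under c) false =>
      if twistAfter c then D.lastStep twistAfter σ (D.next.symm (.under c)) else .twist σ c true
  | .cross σ p false => D.lastStep twistAfter σ (D.next.symm p)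
  | .twist σ c false =>
      if twistAfter c then .cross σ (.under c) true
      else D.lastStep twistAfter σ (D.next.symm (.under c))

theorem stepPrevFun_firstStep (D : VirtualLinkDiagram) (twistAfter : D.Classical → Bool)
    (σ : Side) (p : Passage D.Classical D.Virtual) :
    D.stepPrevFun twistAfter (D.firstStep twistAfter σ p) =
      D.lastStep twistAfter σ (D.next.symm p) := by
  rcases p with c | c | v | v <;> try rfl
  cases h : twistAfter c <;> simp [firstStep, stepPrevFun, h]

theorem stepNextFun_lastStep (D : VirtualLinkDiagram) (twistAfter : D.Classical → Bool)
    (σ : Side) (p : Passage D.Classical D.Virtual) :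
    D.stepNextFun twistAfter (D.lastStep twistAfter σ p) =
      D.firstStep twistAfter σ (D.next p) := by
  rcases p with c | c | v | v <;> try rfl
  cases h : twistAfter c <;> simp [lastStep, stepNextFun, h]

/-- The step that comes next along the copies, as a permutation. -/
def stepNext (D : VirtualLinkDiagram) (twistAfter : D.Classical → Bool) :
    Equiv.Perm (ParallelStep D.Classical D.Virtual) where
  toFun := D.stepNextFun twistAfter
  invFun := D.stepPrevFun twistAfter
  left_inv := by
    rintro (⟨σ, c | c | v | v, _ | _⟩ | ⟨σ, c, _ | _⟩) <;>
      first
        | rfl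
        | (simp [stepNextFun, stepPrevFun_firstStep, lastStep]; done)
        | (cases h : twistAfter c <;>
            first
              | (simp [stepNextFun, stepPrevFun_firstStep, lastStep, h]; done)
              | simp [stepNextFun, stepPrevFun, h])
  right_inv := by
    rintro (⟨σ, c | c | v | v, _ | _⟩ | ⟨σ, c, _ | _⟩) <;>
      first
        | rfl
        | (simp [stepPrevFun, stepNextFun_lastStep, firstStep]; done)
        | (cases h : twistAfter c <;>
            first
              | (simp [stepPrevFun, stepNextFun_lastStep, firstStep, h]; done)
              | simp [stepPrevFun, stepNextFun, h])

instance finite_side : Finite Side :=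
  Finite.of_injective (fun s : Side => match s with | .R => true | .L => false)
    (by rintro (_ | _) (_ | _) <;> simp)

instance finite_parallelClassical (C : Type) [Finite C] : Finite (ParallelClassical C) :=
  Finite.of_injective (fun x : ParallelClassical C =>
      (match x with | .square c τ => .inl (c, τ) | .twist c => .inr c : C × Side ⊕ C))
    (by rintro (_ | _) (_ | _) <;> simp)

instance finite_parallelVirtual (C V : Type) [Finite C] [Finite V] :
    Finite (ParallelVirtual C V) :=
  Finite.of_injective (fun x : ParallelVirtual C V =>
      (match x with
        | .square c τ => .inl (c, τ)
        | .twist c => .inr (.inl c)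
        | .quad v σ τ => .inr (.inr (v, σ, τ)) : C × Side ⊕ C ⊕ V × Side × Side))
    (by rintro (_ | _ | _) (_ | _ | _) <;> simp)

/-- The parallel diagram `φ₊(D)`, both copies being oriented as `D`: the `R` copy of the over
strand passes over both copies of the under strand, all crossings of the `L` copy of the over
strand are virtual, the two copies of the under strand have a twist next to the crossing, a virtual
crossing is replaced by four virtual crossings, and everything else is just doubled. -/
def parallel (D : VirtualLinkDiagram) (twistAfter : D.Classical → Bool) : VirtualLinkDiagram where
  Classical := ParallelClassical D.Classical
  Virtual := ParallelVirtual D.Classical D.Virtual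
  Circle := Side × D.Circle
  finite_classical := by
    have := D.finite_classical
    infer_instance
  finite_virtual := by
    have := D.finite_classical
    have := D.finite_virtual
    infer_instance
  finite_circle := by
    have := D.finite_circle
    infer_instance
  sign
    | .square c _ => D.sign c
    | .twist c => !D.sign c
  next := D.stepEquiv.permCongr (D.stepNext twistAfter)

/-- The edge of `φ₊(D)` that is the `σ` copy of (the middle part of) an edge of `D`. -/
def parallelEdge (D : VirtualLinkDiagram) (twistAfter : D.Classical → Bool) (σ : Side) :
    D.Edge → (D.parallel twistAfter).Edge
  | .inl p => .inl (D.stepToPassage (D.lastStep twistAfter σ p))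
  | .inr o => .inr (σ, o)

end VirtualLinkDiagram

/-!
The fundamental quandle represents colourings: homomorphisms `Q(E) → X` are the colourings of the
edges of `E` by elements of `X` that satisfy the crossing relations. So the theorem amounts to
describing the colourings of the parallel diagram.

Such a colouring is determined by the colours `r` and `l` of the `R` and `L` copies of the edges
of `D`. The `R` copy is never under the `L` copy, so `r` is just a colouring of `D`, that is a
homomorphism `ρ : Q(D) → X`. At a classical crossing of sign `ε`, the `L` copy of the under strand
passes under the `R` copy of the over arc `b` with sign `ε` and, in the twist, under its companion
with sign `-ε`. By self-distributivity the position of the twist does not matter, and the colour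
`l` changes by the element `a ^ (-ε) * b ^ ε` of `As(Q(D))`, where `a` is the incoming under arc
(`stepColor`, `isStepColoring_stepColor`, `IsStepColoring.spec`, `transfer`).

The word `w` read off from an edge `e` up to a later edge conjugates the letter of `e` into that of
the later edge. Hence the product of the factors `a ^ (-ε) * b ^ ε` telescopes to
`e ^ (-s) * w`, with `s` the exponent sum of `w` (`skewProduct_edgeTransfer_pow`). For a full turn
`w` commutes with the letter of `e`, and the product is the preferred longitude
(`skewProduct_edgeTransfer_minimalPeriod`). So the colours of the `L` copy over one component
amount to a single element `y j`, the colour over the base edge, subject to the only condition that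
the longitude fixes it (`exists_section`, `section_unique`). This is the universal property of the
presentation in the theorem; `exists_parallel_presentation` spells out the two mutually inverse
homomorphisms.
-/

/-! ### Quandle operations with a sign, and the right action of the associated group -/

/-- The operation `x * q` (`ε = true`) or `x *̄ q` (`ε = false`). -/
def Rack.signedOp {X : Type*} [Rack X] (ε : Bool) (q x : X) : X :=
  if ε then q ◃⁻¹ x else q ◃ x

theorem ShelfHom.map_invAct {X Y : Type*} [Rack X] [Rack Y] (f : X →◃ Y) (x y : X) :
    f (x ◃⁻¹ y) = f x ◃⁻¹ f y := by
  rw [← Rack.left_cancel (f x), ← f.map_act, Rack.act_invAct_eq, Rack.act_invAct_eq]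

theorem ShelfHom.map_signedOp {X Y : Type*} [Rack X] [Rack Y] (f : X →◃ Y) (ε : Bool) (q x : X) :
    f (Rack.signedOp ε q x) = Rack.signedOp ε (f q) (f x) := by
  cases ε <;> simp [Rack.signedOp, f.map_invAct]

namespace Rack

variable {Q X : Type*} [Rack Q] [Rack X]

/-- The canonical map to the associated group, with values in the group itself rather than in its
conjugation quandle. -/
def envelOf (q : Q) : EnvelGroup Q := toEnvelGroup Q q

theorem envelOf_act (q r : Q) : envelOf (q ◃ r) = envelOf q * envelOf r * (envelOf q)⁻¹ :=
  (toEnvelGroup Q).map_act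

theorem envelOf_invAct (q r : Q) :
    envelOf (q ◃⁻¹ r) = (envelOf q)⁻¹ * envelOf r * envelOf q := by
  have h := envelOf_act q (q ◃⁻¹ r)
  rw [act_invAct_eq] at h
  rw [h]
  group

theorem envelOf_signedOp (ε : Bool) (q r : Q) :
    envelOf (signedOp ε q r) =
      (envelOf q ^ (if ε then (1 : ℤ) else -1))⁻¹ * envelOf r *
        envelOf q ^ (if ε then (1 : ℤ) else -1) := by
  cases ε <;> simp [signedOp, envelOf_act, envelOf_invAct]

/-- The action of the associated group of `Q` on a rack `X` under `Q`: the element `q` of `Q` acts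
by `ρ q ◃ ·`. -/
def envelHom (ρ : Q →◃ X) : EnvelGroup Q →* Equiv.Perm X :=
  toEnvelGroup.map ((toConj X).comp ρ)

/-- The power `x ^ g` for `g` in the associated group of `Q`, with `x ^ q = x * ρ q`. It is a
right action, hence the inverse. -/
def envelPow (ρ : Q →◃ X) (x : X) (g : EnvelGroup Q) : X := (envelHom ρ g)⁻¹ x

@[simp]
theorem envelPow_one (ρ : Q →◃ X) (x : X) : envelPow ρ x 1 = x := by
  simp [envelPow]

theorem envelPow_mul (ρ : Q →◃ X) (x : X) (g h : EnvelGroup Q) :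
    envelPow ρ x (g * h) = envelPow ρ (envelPow ρ x g) h := by
  simp [envelPow]

theorem envelPow_signed (ρ : Q →◃ X) (x : X) (ε : Bool) (q : Q) :
    envelPow ρ x (envelOf q ^ (if ε then (1 : ℤ) else -1)) = signedOp ε (ρ q) x := by
  have h : envelHom ρ (envelOf q) = act' (ρ q) := rfl
  cases ε <;> simp [envelPow, signedOp, h]

end Rack

/-! ### The universal property of a presented quandle -/

namespace QuandleTerm

variable {ι ι' κ X Y : Type*} [Quandle X] [Quandle Y]

/-- The value of an expression in a quandle. -/
def eval (f : ι → X) : QuandleTerm ι → X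
  | var i => f i
  | op a b => eval f b ◃⁻¹ eval f a
  | opInv a b => eval f b ◃ eval f a

theorem eval_map (f : ι' → X) (g : ι → ι') (t : QuandleTerm ι) :
    (t.map g).eval f = t.eval (f ∘ g) := by
  induction t with
  | var i => rfl
  | op a b iha ihb => simp [map, eval, iha, ihb]
  | opInv a b iha ihb => simp [map, eval, iha, ihb]

theorem map_eval (φ : X →◃ Y) (f : ι → X) (t : QuandleTerm ι) :
    φ (t.eval f) = t.eval (φ ∘ f) := by
  induction t with
  | var i => rfl
  | op a b iha ihb => simp [eval, φ.map_invAct, iha, ihb]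
  | opInv a b iha ihb => simp [eval, iha, ihb]

theorem Rel.eval_eq {rel : κ → QuandleTerm ι × QuandleTerm ι} {f : ι → X}
    (hf : ∀ k, (rel k).1.eval f = (rel k).2.eval f) {s t : QuandleTerm ι} (h : Rel rel s t) :
    s.eval f = t.eval f := by
  induction h with
  | of k => exact hf k
  | refl a => rfl
  | symm _ ih => exact ih.symm
  | trans _ _ ih₁ ih₂ => exact ih₁.trans ih₂
  | congr_op _ _ ih₁ ih₂ => simp [eval, ih₁, ih₂]
  | congr_opInv _ _ ih₁ ih₂ => simp [eval, ih₁, ih₂]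
  | idem a => exact Quandle.fix_inv
  | opInv_op a b => exact Rack.act_invAct_eq _ _
  | op_opInv a b => exact Rack.invAct_act_eq _ _
  | distrib a b c => exact Rack.self_distrib_inv

end QuandleTerm

namespace PresentedQuandle

variable {ι κ X : Type*} [Quandle X] {rel : κ → QuandleTerm ι × QuandleTerm ι}

theorem eval_of (t : QuandleTerm ι) : t.eval (of rel) = mk rel t := by
  induction t with
  | var i => rfl
  | op a b iha ihb => rw [QuandleTerm.eval, iha, ihb]; rfl
  | opInv a b iha ihb => rw [QuandleTerm.eval, iha, ihb]; rfl

theorem eval_of_rel (k : κ) : (rel k).1.eval (of rel) = (rel k).2.eval (of rel) := by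
  rw [eval_of, eval_of]
  exact Quotient.sound (QuandleTerm.Rel.of k)

/-- The homomorphism out of a presented quandle given by values of the generators that satisfy
the relations. -/
def lift (f : ι → X) (hf : ∀ k, (rel k).1.eval f = (rel k).2.eval f) :
    PresentedQuandle rel →◃ X where
  toFun := Quotient.lift (QuandleTerm.eval f) fun _ _ h => QuandleTerm.Rel.eval_eq hf h
  map_act' := by
    rintro ⟨a⟩ ⟨b⟩
    rfl

theorem hom_ext {f g : PresentedQuandle rel →◃ X} (h : ∀ i, f (of rel i) = g (of rel i))
    (q : PresentedQuandle rel) : f q = g q := by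
  obtain ⟨t⟩ := q
  change f (mk rel t) = g (mk rel t)
  rw [← eval_of, QuandleTerm.map_eval, QuandleTerm.map_eval]
  exact congrArg (fun u => t.eval u) (funext h)

end PresentedQuandle

section Words

variable {ι ι' Q X : Type*} [Quandle Q] [Quandle X]

theorem wordValue_nil (gen : ι → Q) : wordValue gen [] = 1 :=
  map_one (FreeGroup.lift _)

theorem wordValue_append (gen : ι → Q) (v w : GroupWord ι) :
    wordValue gen (v ++ w) = wordValue gen v * wordValue gen w := by
  rw [wordValue, ← FreeGroup.mul_mk, map_mul]
  rfl

theorem wordValue_singleton (gen : ι → Q) (l : ι × Bool) :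
    wordValue gen [l] = Rack.envelOf (gen l.1) ^ (if l.2 then (1 : ℤ) else -1) := by
  obtain ⟨i, _ | _⟩ := l <;> simp [wordValue, Rack.envelOf]

/-- The value of `t ^ w` depends on `w` only through its value in the associated group. -/
theorem QuandleTerm.eval_pow_map (ρ : Q →◃ X) (gen : ι → Q) (f : ι' → X) (g : ι → ι')
    (hf : ∀ i, f (g i) = ρ (gen i)) (w : GroupWord ι) (t : QuandleTerm ι') :
    (t.pow (w.map fun l => (g l.1, l.2))).eval f =
      Rack.envelPow ρ (t.eval f) (wordValue gen w) := by
  induction w generalizing t with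
  | nil => simp [pow, wordValue_nil]
  | cons l w ih =>
    rw [← List.singleton_append, wordValue_append, Rack.envelPow_mul, wordValue_singleton,
      Rack.envelPow_signed, ← hf]
    refine (ih _).trans (congrArg (fun x => Rack.envelPow ρ x _) ?_)
    obtain ⟨i, _ | _⟩ := l <;> rfl

theorem VirtualLinkDiagram.exponentSum_append (v w : GroupWord ι) :
    exponentSum (v ++ w) = exponentSum v + exponentSum w := by
  simp [exponentSum]

end Words

/-! ### Sections of a cocycle over a permutation -/

section Cocycle

variable {E X J : Type*} (σ : Equiv.Perm E) (T : E → Equiv.Perm X)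

/-- The skew product over `σ` with fibre maps `T`: it sends `(e, x)` to `(σ e, T e x)`. -/
def skewProduct : Equiv.Perm (E × X) := Equiv.prodShear σ T

theorem skewProduct_zpow_fst (k : ℤ) (z : E × X) : ((skewProduct σ T ^ k) z).1 = (σ ^ k) z.1 := by
  induction k using Int.induction_on generalizing z with
  | zero => rfl
  | succ k ih => rw [zpow_add_one, zpow_add_one, Equiv.Perm.mul_apply, ih]; rfl
  | pred k ih => rw [zpow_sub_one, zpow_sub_one, Equiv.Perm.mul_apply, ih]; rfl

variable {σ T}

/-- The graph of a section of the cocycle is invariant under the skew product. -/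
theorem skewProduct_zpow_section {l : E → X} (hl : ∀ e, l (σ e) = T e (l e)) (k : ℤ) (e : E) :
    (skewProduct σ T ^ k) (e, l e) = ((σ ^ k) e, l ((σ ^ k) e)) := by
  have h : ∀ e, skewProduct σ T (e, l e) = (σ e, l (σ e)) := fun e => by rw [hl]; rfl
  have h' : ∀ e, (skewProduct σ T)⁻¹ (e, l e) = (σ⁻¹ e, l (σ⁻¹ e)) := fun e => by
    rw [Equiv.Perm.inv_eq_iff_eq, h]
    simp
  induction k using Int.induction_on generalizing e with
  | zero => rfl
  | succ k ih => rw [zpow_add_one, zpow_add_one, Equiv.Perm.mul_apply, h, ih]; rfl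
  | pred k ih => rw [zpow_sub_one, zpow_sub_one, Equiv.Perm.mul_apply, h', ih]; rfl

theorem section_unique {b : J → E} (hb : ∀ e, ∃ j, σ.SameCycle (b j) e) {l l' : E → X}
    (hl : ∀ e, l (σ e) = T e (l e)) (hl' : ∀ e, l' (σ e) = T e (l' e))
    (h : ∀ j, l (b j) = l' (b j)) (e : E) : l e = l' e := by
  obtain ⟨j, k, rfl⟩ := hb e
  have h₁ := skewProduct_zpow_section hl k (b j)
  rw [h, skewProduct_zpow_section hl'] at h₁
  exact (congrArg Prod.snd h₁).symm

/-- A section of the cocycle may be prescribed at one point of each cycle, provided that going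
once around the cycle brings the prescribed value back to itself. -/
theorem exists_section {b : J → E} (hb : ∀ e, ∃! j, σ.SameCycle (b j) e) (y : J → X)
    (hy : ∀ j, (skewProduct σ T ^ Function.minimalPeriod σ (b j)) (b j, y j) = (b j, y j)) :
    ∃ l : E → X, (∀ e, l (σ e) = T e (l e)) ∧ ∀ j, l (b j) = y j := by
  choose j hj huniq using hb
  choose k hk using hj
  set Φ := skewProduct σ T with hΦ
  let l : E → X := fun e => ((Φ ^ k e) (b (j e), y (j e))).2
  have key : ∀ (i : J) (m : ℤ), l ((σ ^ m) (b i)) = ((Φ ^ m) (b i, y i)).2 := by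
    intro i m
    have hi : j ((σ ^ m) (b i)) = i := (huniq _ i ⟨m, rfl⟩).symm
    have hk' := hk ((σ ^ m) (b i))
    simp only [l]
    rw [hi] at hk' ⊢
    generalize k ((σ ^ m) (b i)) = n at hk' ⊢
    have hfix : (σ ^ (-m + n)) (b i) = b i := by
      rw [zpow_add, Equiv.Perm.mul_apply, hk', zpow_neg]
      simp
    have hdvd : (Function.minimalPeriod σ (b i) : ℤ) ∣ -m + n :=
      
      (MulAction.zpow_smul_eq_iff_minimalPeriod_dvd (a := σ) (b := b i)).mp hfix
    obtain ⟨d, hd⟩ := hdvd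
    have hn : n = m + Function.minimalPeriod σ (b i) * d := by omega
    have hfix' : ((Φ ^ Function.minimalPeriod σ (b i)) ^ d) (b i, y i) = (b i, y i) :=
      Equiv.Perm.zpow_apply_eq_self_of_apply_eq_self (hy i) d
    rw [hn, zpow_add, zpow_mul, zpow_natCast, Equiv.Perm.mul_apply, hfix']
  refine ⟨l, fun e => ?_, fun i => key i 0⟩
  obtain ⟨m, hm⟩ : ∃ m : ℤ, (σ ^ m) (b (j e)) = e := ⟨k e, hk e⟩
  have h₁ := key (j e) (1 + m)
  rw [zpow_add, zpow_add, zpow_one, zpow_one, Equiv.Perm.mul_apply, Equiv.Perm.mul_apply, hm] at h₁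
  rw [h₁]
  have h₂ := key (j e) m
  rw [hm] at h₂
  rw [h₂]
  have h₃ := skewProduct_zpow_fst σ T m (b (j e), y (j e))
  rw [hm] at h₃
  change T ((Φ ^ m) (b (j e), y (j e))).1 _ = _
  rw [h₃]

end Cocycle

/-! ### Colourings of a diagram and of its parallel -/

/-- The maps `signedOp ε a` are automorphisms of the rack. -/
theorem Rack.signedOp_distrib {X : Type*} [Rack X] (ε δ : Bool) (a b x : X) :
    signedOp ε a (signedOp δ b x) = signedOp δ (signedOp ε a b) (signedOp ε a x) := by
  cases ε <;> cases δ <;> simp only [signedOp, if_true, if_false, Bool.false_eq_true]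
  · exact self_distrib
  · rw [← left_cancel (a ◃ b), act_invAct_eq, ← self_distrib, act_invAct_eq]
  · rw [← left_cancel a, act_invAct_eq, self_distrib, act_invAct_eq, act_invAct_eq]
  · exact self_distrib_inv

namespace VirtualLinkDiagram

variable {X Y : Type*} [Quandle X] [Quandle Y] (D : VirtualLinkDiagram)
  (twistAfter : D.Classical → Bool)

/-- The effect of a passage on the colour of the strand that passes, the other edges being coloured
by `r`. -/
def passThrough (r : D.Edge → X) : Passage D.Classical D.Virtual → X → X
  | .under c => Rack.signedOp (D.sign c) (r (.inl (.over c)))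
  | _ => id

/-- A colouring of the edges by elements of a quandle that satisfies the relation at each
passage. -/
def IsColoring (r : D.Edge → X) : Prop :=
  ∀ p, r (.inl p) = D.passThrough r p (r (.inl (D.next.symm p)))

theorem wirtingerRel_eval_iff (r : D.Edge → X) (p : Passage D.Classical D.Virtual) :
    (D.wirtingerRel p).1.eval r = (D.wirtingerRel p).2.eval r ↔
      r (.inl p) = D.passThrough r p (r (.inl (D.next.symm p))) := by
  rcases p with c | c | v | v <;> try exact Iff.rfl
  cases h : D.sign c
  · simp only [wirtingerRel, passThrough, h, Rack.signedOp, QuandleTerm.eval, if_false,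
      Bool.false_eq_true]
    rw [← Rack.left_cancel (r (.inl (.over c))), Rack.act_invAct_eq]
  · simp only [wirtingerRel, passThrough, h, Rack.signedOp, QuandleTerm.eval, if_true]
    exact eq_comm

theorem isColoring_arc : D.IsColoring D.arc := fun p =>
  (D.wirtingerRel_eval_iff D.arc p).mp (PresentedQuandle.eval_of_rel p)

variable {D} in
/-- The homomorphism from the fundamental quandle given by a colouring. -/
def IsColoring.hom {r : D.Edge → X} (hr : D.IsColoring r) : D.FundamentalQuandle →◃ X :=
  PresentedQuandle.lift r fun p => (D.wirtingerRel_eval_iff r p).mpr (hr p)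

theorem map_passThrough (φ : X →◃ Y) (r : D.Edge → X) (p : Passage D.Classical D.Virtual) (x : X) :
    φ (D.passThrough r p x) = D.passThrough (φ ∘ r) p (φ x) := by
  rcases p with c | c | v | v <;> first | rfl | exact φ.map_signedOp _ _ _

variable {D} in
theorem IsColoring.map {r : D.Edge → X} (hr : D.IsColoring r) (φ : X →◃ Y) :
    D.IsColoring (φ ∘ r) := fun p => by
  rw [Function.comp_apply, hr p, map_passThrough]
  rfl

/-- The effect of a passage of `D` on the colour of the `L` copy in the parallel diagram, when the
`R` copy is coloured by `r`. At a classical crossing the `L` copy of the under strand passes under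
the `R` copy of the over strand and, in the twist, under its own companion, with opposite signs. -/
def secondaryThrough (r : D.Edge → X) : Passage D.Classical D.Virtual → X → X
  | .under c => fun x => Rack.signedOp (D.sign c) (r (.inl (.over c)))
      (Rack.signedOp (!D.sign c) (r (.inl (D.next.symm (.under c)))) x)
  | _ => id

/-- A colouring `l` of the `L` copy that is compatible with the colouring `r` of the `R` copy. -/
def IsSecondaryColoring (r l : D.Edge → X) : Prop :=
  ∀ p, l (.inl p) = D.secondaryThrough r p (l (.inl (D.next.symm p)))

theorem map_secondaryThrough (φ : X →◃ Y) (r : D.Edge → X) (p : Passage D.Classical D.Virtual)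
    (x : X) : φ (D.secondaryThrough r p x) = D.secondaryThrough (φ ∘ r) p (φ x) := by
  rcases p with c | c | v | v <;> try rfl
  simp [secondaryThrough, φ.map_signedOp]

variable {D} in
theorem IsSecondaryColoring.map {r l : D.Edge → X} (hl : D.IsSecondaryColoring r l) (φ : X →◃ Y) :
    D.IsSecondaryColoring (φ ∘ r) (φ ∘ l) := fun p => by
  rw [Function.comp_apply, hl p, map_secondaryThrough]
  rfl

/-- The analogue of `passThrough` for the steps of the parallel diagram, `f s` being the colour of
the edge that leaves the step `s`. -/
def stepThrough (f : ParallelStep D.Classical D.Virtual → X) :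
    ParallelStep D.Classical D.Virtual → X → X
  | .cross .R (.under c) k => if k = !D.sign c then
      Rack.signedOp (D.sign c) (f (.cross .R (.over c) (D.sign c))) else id
  | .cross .L (.under c) k => if k = !D.sign c then
      Rack.signedOp (D.sign c) (f (.cross .R (.over c) (!D.sign c))) else id
  | .twist .L c k => if k = !D.sign c then
      Rack.signedOp (!D.sign c) (f (.twist .R c (!D.sign c))) else id
  | _ => id

/-- A colouring of the parallel diagram, read on steps. -/
def IsStepColoring (f : ParallelStep D.Classical D.Virtual → X) : Prop :=
  ∀ s, f s = D.stepThrough f s (f (D.stepPrevFun twistAfter s))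

theorem passThrough_stepToPassage (g : (D.parallel twistAfter).Edge → X)
    (s : ParallelStep D.Classical D.Virtual) :
    (D.parallel twistAfter).passThrough g (D.stepToPassage s) =
      D.stepThrough (fun s => g (.inl (D.stepToPassage s))) s := by
  rcases s with ⟨_ | _, c | c | v | v, _ | _⟩ | ⟨_ | _, c, _ | _⟩ <;>
    first
      | rfl
      | (cases h : D.sign c <;> simp [stepToPassage, passThrough, stepThrough, parallel, h])

theorem isColoring_parallel_iff (g : (D.parallel twistAfter).Edge → X) :
    (D.parallel twistAfter).IsColoring g ↔
      D.IsStepColoring twistAfter fun s => g (.inl (D.stepToPassage s)) := by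
  refine (D.stepEquiv.forall_congr fun s => ?_).symm
  have h : (D.parallel twistAfter).next.symm (D.stepToPassage s) =
      D.stepToPassage (D.stepPrevFun twistAfter s) := by
    change D.stepToPassage (D.stepPrevFun twistAfter (D.passageToStep (D.stepToPassage s))) = _
    exact congrArg (fun s => D.stepToPassage (D.stepPrevFun twistAfter s)) (D.stepEquiv.left_inv s)
  change _ ↔ g (.inl (D.stepToPassage s)) = (D.parallel twistAfter).passThrough g
    (D.stepToPassage s) (g (.inl ((D.parallel twistAfter).next.symm (D.stepToPassage s))))
  rw [passThrough_stepToPassage, h]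

/-- The colouring of the steps of the parallel diagram determined by colours `r` and `l` of the two
copies of every edge of `D`. The condition `D.sign c || k` says that the classical crossing
among the two crossings of the pair has been passed after the step `k`. -/
def stepColor (r l : D.Edge → X) : ParallelStep D.Classical D.Virtual → X
  | .cross .R (.under c) k =>
      if D.sign c || k then r (.inl (.under c)) else r (.inl (D.next.symm (.under c)))
  | .cross .L (.under c) k =>
      let before := l (.inl (D.next.symm (.under c)))
      if twistAfter c then
        if D.sign c || k then Rack.signedOp (D.sign c) (r (.inl (.over c))) before else before
      else
        if D.sign c || k then l (.inl (.under c))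
        else Rack.signedOp (!D.sign c) (r (.inl (D.next.symm (.under c)))) before
  | .twist .R c _ =>
      if twistAfter c then r (.inl (.under c)) else r (.inl (D.next.symm (.under c)))
  | .twist .L c k =>
      let before := l (.inl (D.next.symm (.under c)))
      if twistAfter c then
        if D.sign c || k then l (.inl (.under c))
        else Rack.signedOp (D.sign c) (r (.inl (.over c))) before
      else
        if D.sign c || k then
          Rack.signedOp (!D.sign c) (r (.inl (D.next.symm (.under c)))) before
        else before
  | .cross .R p _ => r (.inl p)
  | .cross .L p _ => l (.inl p)

theorem stepColor_lastStep_R (r l : D.Edge → X) (p : Passage D.Classical D.Virtual) :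
    D.stepColor twistAfter r l (D.lastStep twistAfter .R p) = r (.inl p) := by
  rcases p with c | c | v | v <;> try rfl
  cases h : twistAfter c <;> simp [lastStep, stepColor, h]

theorem stepColor_lastStep_L (r l : D.Edge → X) (p : Passage D.Classical D.Virtual) :
    D.stepColor twistAfter r l (D.lastStep twistAfter .L p) = l (.inl p) := by
  rcases p with c | c | v | v <;> try rfl
  cases h : twistAfter c <;> simp [lastStep, stepColor, h]

theorem isStepColoring_stepColor {r l : D.Edge → X} (hr : D.IsColoring r)
    (hl : D.IsSecondaryColoring r l) :
    D.IsStepColoring twistAfter (D.stepColor twistAfter r l) := by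
  have hR := D.stepColor_lastStep_R twistAfter r l
  have hL := D.stepColor_lastStep_L twistAfter r l
  rintro (⟨_ | _, c | c | v | v, _ | _⟩ | ⟨σ, c, k⟩)
  case cross.R.over.false => exact (hr (.over c)).trans (hR _).symm
  case cross.R.left.false => exact (hr (.left v)).trans (hR _).symm
  case cross.R.right.false => exact (hr (.right v)).trans (hR _).symm
  case cross.L.over.false => exact (hl (.over c)).trans (hL _).symm
  case cross.L.left.false => exact (hl (.left v)).trans (hL _).symm
  case cross.L.right.false => exact (hl (.right v)).trans (hL _).symm
  case twist =>
    have h := hr (.under c)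
    have h' := hl (.under c)
    have hd := Rack.signedOp_distrib (D.sign c) (!D.sign c) (r (.inl (.over c)))
      (r (.inl (D.next.symm (.under c)))) (l (.inl (D.next.symm (.under c))))
    specialize hR (D.next.symm (.under c))
    specialize hL (D.next.symm (.under c))
    rw [passThrough] at h
    simp only [secondaryThrough] at h'
    rw [hd, ← h] at h'
    cases σ <;> cases k <;> cases hs : D.sign c <;> cases ht : twistAfter c <;>
      simp only [hs] at h' <;>
      simp [stepPrevFun, stepThrough, hs, ht, hR, hL] <;>
      simp [stepColor, hs, ht, h']
  case cross.R.under.false | cross.R.under.true | cross.L.under.false | cross.L.under.true =>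
    have h := hr (.under c)
    have h' := hl (.under c)
    specialize hR (D.next.symm (.under c))
    specialize hL (D.next.symm (.under c))
    cases hs : D.sign c <;> cases ht : twistAfter c <;>
      simp [passThrough, secondaryThrough, hs] at h h' <;>
      simp [stepPrevFun, stepThrough, hs, ht, hR, hL] <;>
      simp [stepColor, hs, ht, h', h]
  all_goals rfl

variable {D twistAfter} in
/-- A colouring of the steps restricts to compatible colourings of the two copies, and it is
determined by them. -/
theorem IsStepColoring.spec {f : ParallelStep D.Classical D.Virtual → X}
    (hf : D.IsStepColoring twistAfter f) {r l : D.Edge → X}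
    (hr : ∀ p, r (.inl p) = f (D.lastStep twistAfter .R p))
    (hl : ∀ p, l (.inl p) = f (D.lastStep twistAfter .L p)) :
    D.IsColoring r ∧ D.IsSecondaryColoring r l ∧ f = D.stepColor twistAfter r l := by
  have hR : ∀ c, f (.cross .R (.over c) false) = r (.inl (.over c)) := fun c =>
    (hf (.cross .R (.over c) true)).symm.trans (hr (.over c)).symm
  have hR' : ∀ c, f (.cross .R (.over c) true) = r (.inl (.over c)) := fun c =>
    (hr (.over c)).symm
  have under : ∀ c,
      r (.inl (.under c)) = D.passThrough r (.under c) (r (.inl (D.next.symm (.under c)))) ∧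
      l (.inl (.under c)) = D.secondaryThrough r (.under c) (l (.inl (D.next.symm (.under c)))) ∧
      ∀ σ k, f (.cross σ (.under c) k) = D.stepColor twistAfter r l (.cross σ (.under c) k) ∧
        f (.twist σ c k) = D.stepColor twistAfter r l (.twist σ c k) := by
    intro c
    have hd := Rack.signedOp_distrib (D.sign c) (!D.sign c) (r (.inl (.over c)))
      (r (.inl (D.next.symm (.under c)))) (l (.inl (D.next.symm (.under c))))
    have h₁ := hf (.cross .R (.under c) false)
    have h₂ := hf (.cross .R (.under c) true)
    have h₃ := hf (.twist .R c false)
    have h₄ := hf (.twist .R c true)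
    have h₅ := hf (.cross .L (.under c) false)
    have h₆ := hf (.cross .L (.under c) true)
    have h₇ := hf (.twist .L c false)
    have h₈ := hf (.twist .L c true)
    have i₁ := hr (.under c)
    have i₂ := hl (.under c)
    have i₃ := hr (D.next.symm (.under c))
    have i₄ := hl (D.next.symm (.under c))
    cases hs : D.sign c <;> cases ht : twistAfter c <;>
      simp only [hs, ht, stepPrevFun, stepThrough, if_true, if_false, Bool.not_true,
        Bool.not_false, Bool.false_eq_true, reduceCtorEq, id, hR, hR', ← i₃, ← i₄]
        at h₁ h₂ h₃ h₄ h₅ h₆ h₇ h₈ hd <;>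
      simp only [lastStep, ht, if_true, if_false, Bool.false_eq_true] at i₁ i₂ <;>
      clear hr hl i₃ i₄ hf hR hR' <;>
      refine ⟨?_, ?_, ?_⟩ <;>
      first
        | rintro (_ | _) (_ | _) <;> simp [stepColor, *]
        | simp [passThrough, secondaryThrough, *]
  have other : ∀ p, (∀ c, p ≠ .under c) →
      r (.inl p) = r (.inl (D.next.symm p)) ∧ l (.inl p) = l (.inl (D.next.symm p)) ∧
      ∀ σ k, f (.cross σ p k) = D.stepColor twistAfter r l (.cross σ p k) := by
    intro p hp
    have h₁ := hf (.cross .R p false)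
    have h₂ := hf (.cross .R p true)
    have h₃ := hf (.cross .L p false)
    have h₄ := hf (.cross .L p true)
    have i₁ := hr p
    have i₂ := hl p
    have i₃ := hr (D.next.symm p)
    have i₄ := hl (D.next.symm p)
    rcases p with c | c | v | v
    case under => exact absurd rfl (hp c)
    all_goals
      simp only [stepPrevFun, stepThrough, id, ← i₃, ← i₄] at h₁ h₂ h₃ h₄
      simp only [lastStep] at i₁ i₂
      clear hr hl i₃ i₄ hf hR hR' under
      refine ⟨by simp [*], by simp [*], ?_⟩
      rintro (_ | _) (_ | _) <;> simp [stepColor, *]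
  refine ⟨?_, ?_, ?_⟩
  · rintro (c | c | v | v)
    case under => exact (under c).1
    all_goals exact (other _ (by simp)).1
  · rintro (c | c | v | v)
    case under => exact (under c).2.1
    all_goals exact (other _ (by simp)).2.1
  · funext s
    rcases s with ⟨σ, c | c | v | v, k⟩ | ⟨σ, c, k⟩
    case cross.under => exact ((under c).2.2 σ k).1
    case twist => exact ((under c).2.2 σ k).2
    all_goals exact (other _ (by simp)).2.2 σ k

end VirtualLinkDiagram

/-! ### Transport of the secondary colour and preferred longitudes -/

namespace VirtualLinkDiagram

variable {X : Type*} [Quandle X] (D : VirtualLinkDiagram)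
  (twistAfter : D.Classical → Bool)

/-- The element of the associated group by which the colour of the `L` copy changes at a passage:
the letter read off, preceded by the compensating power of the letter of the incoming edge. -/
noncomputable def transfer (p : Passage D.Classical D.Virtual) :
    Rack.EnvelGroup D.FundamentalQuandle :=
  Rack.envelOf (D.arc (.inl (D.next.symm p))) ^ (-exponentSum (D.passageWord p)) *
    wordValue D.arc (D.passageWord p)

theorem secondaryThrough_eq_envelPow (ρ : D.FundamentalQuandle →◃ X)
    (p : Passage D.Classical D.Virtual) (x : X) :
    D.secondaryThrough (ρ ∘ D.arc) p x = Rack.envelPow ρ x (D.transfer p) := by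
  rcases p with c | c | v | v
  case under =>
    have h : -exponentSum (D.passageWord (.under c)) = if !D.sign c then (1 : ℤ) else -1 := by
      cases h : D.sign c <;> simp [passageWord, exponentSum, h]
    rw [transfer, h, Rack.envelPow_mul, Rack.envelPow_signed, passageWord, wordValue_singleton,
      Rack.envelPow_signed]
    rfl
  all_goals simp [transfer, passageWord, secondaryThrough, exponentSum, wordValue_nil]

/-- Reading off the word at a passage conjugates the letter of the incoming edge into that of the
outgoing edge. -/
theorem semiconjBy_passageWord (p : Passage D.Classical D.Virtual) :
    SemiconjBy (wordValue D.arc (D.passageWord p)) (Rack.envelOf (D.arc (.inl p)))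
      (Rack.envelOf (D.arc (.inl (D.next.symm p)))) := by
  have h := D.isColoring_arc p
  rw [SemiconjBy, h]
  rcases p with c | c | v | v
  case under =>
    rw [passThrough, passageWord, wordValue_singleton, Rack.envelOf_signedOp]
    group
  all_goals simp [passageWord, passThrough, wordValue_nil]

/-- The word read off along the first `n` passages after the edge that leaves `p`. -/
def pathWord (p : Passage D.Classical D.Virtual) (n : ℕ) : GroupWord D.Edge :=
  (List.range n).flatMap fun k => D.passageWord ((D.next ^ (k + 1)) p)

theorem pathWord_succ (p : Passage D.Classical D.Virtual) (n : ℕ) :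
    D.pathWord p (n + 1) = D.pathWord p n ++ D.passageWord ((D.next ^ (n + 1)) p) := by
  simp [pathWord, List.range_succ]

theorem next_symm_next_pow (p : Passage D.Classical D.Virtual) (n : ℕ) :
    D.next.symm ((D.next ^ (n + 1)) p) = (D.next ^ n) p := by
  rw [pow_succ', Equiv.Perm.mul_apply, Equiv.symm_apply_apply]

/-- The word read off along a path conjugates the letter of its first edge into that of its last
edge. -/
theorem semiconjBy_pathWord (p : Passage D.Classical D.Virtual) (n : ℕ) :
    SemiconjBy (wordValue D.arc (D.pathWord p n)) (Rack.envelOf (D.arc (.inl ((D.next ^ n) p))))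
      (Rack.envelOf (D.arc (.inl p))) := by
  induction n with
  | zero => simp [pathWord, wordValue_nil]
  | succ n ih =>
    rw [pathWord_succ, wordValue_append]
    refine ih.mul_left ?_
    have h := D.semiconjBy_passageWord ((D.next ^ (n + 1)) p)
    rwa [next_symm_next_pow] at h

/-- The change of the colour of the `L` copy from an edge of `D` to the next one. -/
noncomputable def edgeTransfer (ρ : D.FundamentalQuandle →◃ X) : D.Edge → Equiv.Perm X
  | .inl p => (Rack.envelHom ρ (D.transfer (D.next p)))⁻¹
  | .inr _ => 1

theorem isSecondaryColoring_iff (ρ : D.FundamentalQuandle →◃ X) (l : D.Edge → X) :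
    D.IsSecondaryColoring (ρ ∘ D.arc) l ↔
      ∀ e, l (D.edgeNext e) = D.edgeTransfer ρ e (l e) := by
  have key : ∀ q, l (D.edgeNext (.inl q)) = D.edgeTransfer ρ (.inl q) (l (.inl q)) ↔
      l (.inl (D.next q)) = D.secondaryThrough (ρ ∘ D.arc) (D.next q)
        (l (.inl (D.next.symm (D.next q)))) := fun q => by
    rw [secondaryThrough_eq_envelPow, Equiv.symm_apply_apply]
    rfl
  constructor
  · rintro h (q | o)
    · exact (key q).mpr (h (D.next q))
    · rfl
  · intro h p
    simpa using (key (D.next.symm p)).mp (h _)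

/-- The compensating powers of the letters of the edges met along the way telescope to a power of
the letter of the initial edge. -/
theorem skewProduct_edgeTransfer_pow (ρ : D.FundamentalQuandle →◃ X)
    (p : Passage D.Classical D.Virtual) (x : X) (n : ℕ) :
    (skewProduct D.edgeNext (D.edgeTransfer ρ) ^ n) (.inl p, x) =
      (.inl ((D.next ^ n) p), Rack.envelPow ρ x
        (Rack.envelOf (D.arc (.inl p)) ^ (-exponentSum (D.pathWord p n)) *
          wordValue D.arc (D.pathWord p n))) := by
  induction n with
  | zero => simp [pathWord, wordValue_nil, exponentSum]
  | succ n ih =>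
    have hq : D.next ((D.next ^ n) p) = (D.next ^ (n + 1)) p := by
      rw [pow_succ', Equiv.Perm.mul_apply]
    have hsemi := ((D.semiconjBy_pathWord p n).zpow_right
      (-exponentSum (D.passageWord ((D.next ^ (n + 1)) p)))).eq
    rw [pow_succ', Equiv.Perm.mul_apply, ih, pathWord_succ, exponentSum_append, wordValue_append,
      neg_add, zpow_add, mul_assoc, ← mul_assoc (_ ^ (-exponentSum (D.passageWord _))), ← hsemi]
    change (Sum.inl (D.next ((D.next ^ n) p)),
      Rack.envelPow ρ _ (D.transfer (D.next ((D.next ^ n) p)))) = _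
    rw [hq, ← Rack.envelPow_mul, transfer, next_symm_next_pow]
    simp only [mul_assoc]

/-- Going once around a component of the `L` copy acts on the colour by the preferred longitude. -/
theorem skewProduct_edgeTransfer_minimalPeriod (ρ : D.FundamentalQuandle →◃ X) (e : D.Edge)
    (x : X) :
    (skewProduct D.edgeNext (D.edgeTransfer ρ) ^ Function.minimalPeriod D.edgeNext e) (e, x) =
      (e, Rack.envelPow ρ x (D.preferredLongitude e)) := by
  rcases e with p | o
  · have hper : Function.minimalPeriod D.edgeNext (.inl p) = Function.minimalPeriod D.next p := by
      refine Function.minimalPeriod_eq_minimalPeriod_iff.mpr fun n => ?_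
      have h : D.edgeNext^[n] (.inl p) = .inl (D.next^[n] p) := by
        induction n with
        | zero => rfl
        | succ n ih => rw [Function.iterate_succ_apply', ih, Function.iterate_succ_apply']; rfl
      rw [Function.IsPeriodicPt, Function.IsFixedPt, h]
      exact Sum.inl_injective.eq_iff
    have hfix : (D.next ^ Function.minimalPeriod D.next p) p = p := by
      rw [Equiv.Perm.coe_pow]
      exact Function.iterate_minimalPeriod
    have hsemi := D.semiconjBy_pathWord p (Function.minimalPeriod D.next p)
    rw [hfix] at hsemi
    rw [hper, skewProduct_edgeTransfer_pow, hfix, ← (hsemi.zpow_right _).eq]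
    rfl
  · have hper : Function.minimalPeriod D.edgeNext (.inr o) = 1 :=
      Function.minimalPeriod_eq_one_iff_isFixedPt.mpr rfl
    have hlong : D.preferredLongitude (.inr o) = 1 := by
      simp [preferredLongitude, longitudeWord, wordValue_nil, exponentSum]
    rw [hper, hlong, Rack.envelPow_one]
    rfl

variable {D} in
/-- The colour of the `L` copy is fixed by the preferred longitudes. -/
theorem IsSecondaryColoring.envelPow_preferredLongitude {ρ : D.FundamentalQuandle →◃ X}
    {l : D.Edge → X} (hl : D.IsSecondaryColoring (ρ ∘ D.arc) l) (e : D.Edge) :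
    Rack.envelPow ρ (l e) (D.preferredLongitude e) = l e := by
  have h := skewProduct_zpow_section ((D.isSecondaryColoring_iff ρ l).mp hl)
    (Function.minimalPeriod D.edgeNext e) e
  rw [zpow_natCast, skewProduct_edgeTransfer_minimalPeriod, zpow_natCast] at h
  have hfix : (D.edgeNext ^ Function.minimalPeriod D.edgeNext e) e = e := congrArg Prod.fst h.symm
  rw [hfix] at h
  exact congrArg Prod.snd h

/-! ### The fundamental quandle of the parallel diagram -/

/-- The colouring of the parallel diagram with prescribed colours on the copies of the edges
of `D`. -/
def parallelColor (r l : D.Edge → X) : (D.parallel twistAfter).Edge → X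
  | .inl q => D.stepColor twistAfter r l (D.passageToStep q)
  | .inr (.R, o) => r (.inr o)
  | .inr (.L, o) => l (.inr o)

theorem isColoring_parallelColor {r l : D.Edge → X} (hr : D.IsColoring r)
    (hl : D.IsSecondaryColoring r l) :
    (D.parallel twistAfter).IsColoring (D.parallelColor twistAfter r l) := by
  rw [isColoring_parallel_iff]
  convert D.isStepColoring_stepColor twistAfter hr hl using 1
  funext s
  exact congrArg (D.stepColor twistAfter r l) (D.stepEquiv.left_inv s)

theorem parallelColor_parallelEdge_R (r l : D.Edge → X) (e : D.Edge) :
    D.parallelColor twistAfter r l (D.parallelEdge twistAfter .R e) = r e := by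
  rcases e with p | o
  · exact (congrArg _ (D.stepEquiv.left_inv _)).trans (D.stepColor_lastStep_R twistAfter r l p)
  · rfl

theorem parallelColor_parallelEdge_L (r l : D.Edge → X) (e : D.Edge) :
    D.parallelColor twistAfter r l (D.parallelEdge twistAfter .L e) = l e := by
  rcases e with p | o
  · exact (congrArg _ (D.stepEquiv.left_inv _)).trans (D.stepColor_lastStep_L twistAfter r l p)
  · rfl

variable {D twistAfter} in
/-- A colouring of the parallel diagram restricts to compatible colourings of the two copies
of `D`, and it is determined by them. -/
theorem IsColoring.parallel_spec {g : (D.parallel twistAfter).Edge → X}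
    (hg : (D.parallel twistAfter).IsColoring g) {r l : D.Edge → X}
    (hr : ∀ e, r e = g (D.parallelEdge twistAfter .R e))
    (hl : ∀ e, l e = g (D.parallelEdge twistAfter .L e)) :
    D.IsColoring r ∧ D.IsSecondaryColoring r l ∧ g = D.parallelColor twistAfter r l := by
  obtain ⟨h₁, h₂, h₃⟩ := IsStepColoring.spec
    ((D.isColoring_parallel_iff twistAfter g).mp hg) (fun p => hr (.inl p)) (fun p => hl (.inl p))
  refine ⟨h₁, h₂, ?_⟩
  funext e
  rcases e with q | ⟨_ | _, o⟩
  · exact (congrArg (fun q => g (.inl q)) (D.stepEquiv.right_inv q)).symm.trans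
      (congrFun h₃ (D.passageToStep q))
  · exact (hr (.inr o)).symm
  · exact (hl (.inr o)).symm

/-- The quandle of the parallel diagram is generated by the copies of the edges of `D`; the short
edges inside a crossing or a twist are not needed. -/
theorem parallel_hom_ext {f g : (D.parallel twistAfter).FundamentalQuandle →◃ X}
    (hR : ∀ e, f ((D.parallel twistAfter).arc (D.parallelEdge twistAfter .R e)) =
      g ((D.parallel twistAfter).arc (D.parallelEdge twistAfter .R e)))
    (hL : ∀ e, f ((D.parallel twistAfter).arc (D.parallelEdge twistAfter .L e)) =
      g ((D.parallel twistAfter).arc (D.parallelEdge twistAfter .L e)))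
    (q : (D.parallel twistAfter).FundamentalQuandle) : f q = g q := by
  have hc := (D.parallel twistAfter).isColoring_arc
  have hf := (IsColoring.parallel_spec (hc.map f) (fun _ => rfl) fun _ => rfl).2.2
  have hg := (IsColoring.parallel_spec (hc.map g) hR hL).2.2
  exact PresentedQuandle.hom_ext (congrFun (hf.trans hg.symm)) q

/-- The quandle of the parallel diagram for an arbitrary family of base edges, one on each
component. -/
theorem exists_parallel_presentation {ι κ J : Type*}
    (gen : ι → D.FundamentalQuandle) (rel : κ → QuandleTerm ι × QuandleTerm ι)
    (hrel : IsQuandlePresentation D.FundamentalQuandle gen rel)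
    (b : J → D.Edge) (hb : ∀ e, ∃! j, D.edgeNext.SameCycle (b j) e) (L : J → GroupWord ι)
    (hL : ∀ j, wordValue gen (L j) = D.preferredLongitude (b j)) :
    ∃ incl : D.FundamentalQuandle →◃ (D.parallel twistAfter).FundamentalQuandle,
      (∀ a, incl (D.arc a) = (D.parallel twistAfter).arc (D.parallelEdge twistAfter .R a)) ∧
      IsQuandlePresentation (D.parallel twistAfter).FundamentalQuandle
        (Sum.elim (fun i => incl (gen i))
          fun j => (D.parallel twistAfter).arc (D.parallelEdge twistAfter .L (b j)))
        (addLongitudeRel rel L) := by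
  obtain ⟨f, hf, hfgen⟩ := hrel
  set P := D.parallel twistAfter
  let r : D.Edge → P.FundamentalQuandle := fun e => P.arc (D.parallelEdge twistAfter .R e)
  let l : D.Edge → P.FundamentalQuandle := fun e => P.arc (D.parallelEdge twistAfter .L e)
  obtain ⟨hr, hl, -⟩ : D.IsColoring r ∧ D.IsSecondaryColoring r l ∧ _ :=
    IsColoring.parallel_spec P.isColoring_arc (fun _ => rfl) fun _ => rfl
  let incl := hr.hom
  -- `hr.hom` takes the arcs of `D` to their `R` copies by definition.
  have hl' : D.IsSecondaryColoring (incl ∘ D.arc) l := hl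
  -- The inverse of `f`, as a homomorphism.
  let finv : D.FundamentalQuandle →◃ PresentedQuandle rel :=
    { toFun := (Equiv.ofBijective f hf).symm
      map_act' := fun {x y} => by
        apply hf.injective
        rw [f.map_act]
        simp only [Equiv.ofBijective_apply_symm_apply] }
  have hfinv : ∀ q, f (finv q) = q := (Equiv.ofBijective f hf).apply_symm_apply
  have hfinv' : ∀ i, finv (gen i) = PresentedQuandle.of rel i := fun i => by
    rw [← hfgen]
    exact (Equiv.ofBijective f hf).symm_apply_apply _
  have hgen : ∀ k, (rel k).1.eval gen = (rel k).2.eval gen := fun k => by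
    have h := congrArg f (PresentedQuandle.eval_of_rel (rel := rel) k)
    rwa [QuandleTerm.map_eval, QuandleTerm.map_eval, show f ∘ PresentedQuandle.of rel = gen from
      funext hfgen] at h
  -- The longitude relations hold in the parallel diagram because the `L` copy closes up.
  let F : PresentedQuandle (addLongitudeRel rel L) →◃ P.FundamentalQuandle :=
    PresentedQuandle.lift (Sum.elim (fun i => incl (gen i)) fun j => l (b j)) <| by
      rintro (k | j)
      · change QuandleTerm.eval _ (QuandleTerm.map _ _) = QuandleTerm.eval _ (QuandleTerm.map _ _)
        rw [QuandleTerm.eval_map, QuandleTerm.eval_map]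
        have h := congrArg incl (hgen k)
        rw [QuandleTerm.map_eval, QuandleTerm.map_eval] at h
        exact h
      · change QuandleTerm.eval _ (QuandleTerm.pow _ _) = _
        rw [QuandleTerm.eval_pow_map incl gen _ Sum.inl fun i => rfl, hL]
        exact hl'.envelPow_preferredLongitude (b j)
  let X := PresentedQuandle (addLongitudeRel rel L)
  let emb : PresentedQuandle rel →◃ X :=
    PresentedQuandle.lift (fun i => PresentedQuandle.of _ (.inl i)) fun k => by
      have h := PresentedQuandle.eval_of_rel (rel := addLongitudeRel rel L) (.inl k)
      change QuandleTerm.eval _ (QuandleTerm.map _ _) =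
        QuandleTerm.eval _ (QuandleTerm.map _ _) at h
      rwa [QuandleTerm.eval_map, QuandleTerm.eval_map] at h
  -- The quandle of `D` maps to the one presented with the letters `y j` added.
  let ρ : D.FundamentalQuandle →◃ X := emb.comp finv
  have hρ : ∀ i, ρ (gen i) = PresentedQuandle.of _ (.inl i) := fun i =>
    congrArg emb (hfinv' i)
  -- Conversely, by the longitude relations the letters `y j` spread to a colouring of the `L` copy.
  obtain ⟨y, hy, hyb⟩ := exists_section (T := D.edgeTransfer ρ) hb
    (fun j => (PresentedQuandle.of (addLongitudeRel rel L) (.inr j) : X)) fun j => by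
      rw [skewProduct_edgeTransfer_minimalPeriod, ← hL]
      have h := PresentedQuandle.eval_of_rel (rel := addLongitudeRel rel L) (.inr j)
      change QuandleTerm.eval _ (QuandleTerm.pow _ _) = _ at h
      rw [QuandleTerm.eval_pow_map ρ gen _ Sum.inl fun i => (hρ i).symm] at h
      exact congrArg (Prod.mk (b j)) h
  have hy' : D.IsSecondaryColoring (ρ ∘ D.arc) y := (D.isSecondaryColoring_iff ρ y).mpr hy
  let G : P.FundamentalQuandle →◃ X :=
    (D.isColoring_parallelColor twistAfter (D.isColoring_arc.map ρ) hy').hom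
  have hGR : ∀ e, G (r e) = ρ (D.arc e) := fun e =>
    D.parallelColor_parallelEdge_R twistAfter (ρ ∘ D.arc) y e
  have hGL : ∀ e, G (l e) = y e := fun e =>
    D.parallelColor_parallelEdge_L twistAfter (ρ ∘ D.arc) y e
  have hGincl : ∀ q, G (incl q) = ρ q :=
    PresentedQuandle.hom_ext (f := G.comp incl) (g := ρ) hGR
  have hFρ : ∀ q, F (ρ q) = incl q := fun q => by
    have h := PresentedQuandle.hom_ext (f := F.comp emb) (g := incl.comp f)
      (fun i => (congrArg incl (hfgen i)).symm) (finv q)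
    exact h.trans (congrArg incl (hfinv q))
  have hGF : ∀ x, G (F x) = x := by
    refine PresentedQuandle.hom_ext (f := G.comp F) (g := ShelfHom.id _) ?_
    rintro (i | j)
    · exact (hGincl (gen i)).trans (hρ i)
    · exact (hGL (b j)).trans (hyb j)
  have hFy : ∀ e, F (y e) = l e := by
    have h₁ := hy'.map F
    rw [show F ∘ ρ ∘ D.arc = incl ∘ D.arc from funext fun e => hFρ _,
      isSecondaryColoring_iff] at h₁
    refine section_unique (fun e => (hb e).exists) h₁ ((D.isSecondaryColoring_iff _ _).mp hl') ?_
    exact fun j => congrArg F (hyb j)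
  have hFG : ∀ x, F (G x) = x := by
    refine D.parallel_hom_ext twistAfter (f := F.comp G) (g := ShelfHom.id _) (fun e => ?_)
      fun e => ?_
    · exact (congrArg F (hGR e)).trans (hFρ _)
    · exact (congrArg F (hGL e)).trans (hFy e)
  refine ⟨incl, fun _ => rfl, F, ⟨?_, ?_⟩, ?_⟩
  · exact Function.LeftInverse.injective hGF
  · exact Function.RightInverse.surjective hFG
  · rintro (i | j) <;> rfl

end VirtualLinkDiagram

/-- The first part is about knots, the second one about links with `μ` components. -/
theorem theorem5p4 {ι κ : Type*} (D : VirtualLinkDiagram) (twistAfter : D.Classical → Bool)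
    (gen : ι → D.FundamentalQuandle) (rel : κ → QuandleTerm ι × QuandleTerm ι)
    (hrel : IsQuandlePresentation D.FundamentalQuandle gen rel) :
    (D.IsKnot → ∀ (e : D.Edge) (L : GroupWord ι), wordValue gen L = D.preferredLongitude e →
      ∃ incl : D.FundamentalQuandle →◃ (D.parallel twistAfter).FundamentalQuandle,
        (∀ a, incl (D.arc a) = (D.parallel twistAfter).arc (D.parallelEdge twistAfter .R a)) ∧
        IsQuandlePresentation (D.parallel twistAfter).FundamentalQuandle
          (Sum.elim (fun i => incl (gen i))
            fun _ : Unit => (D.parallel twistAfter).arc (D.parallelEdge twistAfter .L e))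
          (addLongitudeRel rel fun _ : Unit => L)) ∧
    (∀ (μ : ℕ) (b : Fin μ → D.Edge) (L : Fin μ → GroupWord ι), D.IsBase b →
      (∀ j, wordValue gen (L j) = D.preferredLongitude (b j)) →
      ∃ incl : D.FundamentalQuandle →◃ (D.parallel twistAfter).FundamentalQuandle,
        (∀ a, incl (D.arc a) = (D.parallel twistAfter).arc (D.parallelEdge twistAfter .R a)) ∧
        IsQuandlePresentation (D.parallel twistAfter).FundamentalQuandle
          (Sum.elim (fun i => incl (gen i))
            fun j => (D.parallel twistAfter).arc (D.parallelEdge twistAfter .L (b j)))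
          (addLongitudeRel rel L)) := by
  refine ⟨fun hK e L hL => ?_, fun μ b L hb hL => ?_⟩
  · exact D.exists_parallel_presentation twistAfter gen rel hrel (fun _ : Unit => e)
      (fun e' => ⟨(), hK.2 e e', fun _ _ => rfl⟩) (fun _ => L) fun _ => hL
  · exact D.exists_parallel_presentation twistAfter gen rel hrel b hb L hL
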